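/- Let $h>0$ and $\mathbb N=\{1,2,3,\dots\}$, and write $\mathbf i=ih$ for $i\in\mathbb N$. Let $\alpha_n,\beta_n\ge 0$ ($n=1,2,3$) and $\delta$ be real numbers with $\delta>\max_{n}(\alpha_n+\beta_n)$ and $\delta>2\alpha_1+\beta_1-1$, and put $K_n(\mathbf i,\mathbf j)=\mathbf i^{\alpha_n}\mathbf j^{\alpha_n}(\mathbf i+\mathbf j)^{\beta_n}$. Consider the discrete 3-wave kinetic equation $$\frac{\partial f_i}{\partial t}=S^{(1)}_i[f]+S^{(2)}_i[f]+S^{(3)}_i[f]-\mathbf i^{\delta}f_i,\qquad f_i(0)=f_0(i),\qquad i\in\mathbb N,$$ where $$S^{(1)}_i[f]=\sum_{j=1}^{i-1}K_1(\mathbf j,\mathbf i-\mathbf j)f_jf_{i-j}-2\sum_{j=1}^\infty K_1(\mathbf i,\mathbf j)f_if_j,$$ $$S^{(n)}_i[f]=-\sum_{j=1}^{i-1}K_n(\mathbf i-\mathbf j,\mathbf j)f_if_j+\sum_{j=i+1}^\infty K_n(\mathbf j-\mathbf i,\mathbf i)f_if_j+\sum_{j=i+1}^\infty K_n(\mathbf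 i,\mathbf j-\mathbf i)f_jf_{j-i}\qquad(n=2,3).$$ Let $f_0:\mathbb N\to[0,\infty)$ satisfy $\sum_{i}f_0(i)\,\mathbf i^{\kappa}<\infty$ for some $\kappa>\max\{\delta,1,2-\alpha_1-\beta_1\}$, and let $f\in C^1([0,\infty);\ell^1(\mathbb N))$ be a classical solution of this equation with initial datum $f_0$ for which $\sum_i|f_i(t)|\,\mathbf i^{\delta}$ is bounded on every bounded time interval. Let $I=\{i\in\mathbb N: f_0(i)>0\}$ and let $\gcd(I)$ be the greatest common divisor of the elements of $I$ (with $\gcd(\emptyset)=0$). Then for every $t>0$ and every $i\in\mathbb N$: $f_i(t)>0$ if $i\in\gcd(I)\,\mathbb N$, and $f_i(t)=0$ if $i\notin\gcd(I)\,\mathbb N$. -/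

import Mathlib

open scoped ENNReal

namespace ThreeWave

/-- The physical location `i h` of the `i`-th mesh point. -/
def loc (h : ℝ) (i : ℕ+) : ℝ := (i : ℝ) * h

/-- The symmetric kernel `K(x, y) = x ^ a * y ^ a * (x + y) ^ b`, evaluated at the physical
locations of the indices `i` and `j`. -/
noncomputable def kernel (h a b : ℝ) (i j : ℕ+) : ℝ :=
  loc h i ^ a * loc h j ^ a * (loc h i + loc h j) ^ b

/-- The `k`-th absolute moment `∑ i, |u i| (i h) ^ k`, with values in `[0, ∞]`. For `u ≥ 0` it is
the `k`-th moment of `u`. -/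
noncomputable def moment (h k : ℝ) (u : ℕ+ → ℝ) : ℝ≥0∞ :=
  ∑' i : ℕ+, ENNReal.ofReal (|u i| * loc h i ^ k)

/-- The coagulation operator
`∑_{j=1}^{i-1} K(j, i-j) u_j u_{i-j} - 2 ∑_{j=1}^∞ K(i, j) u_i u_j`. -/
noncomputable def coagulation (K : ℕ+ → ℕ+ → ℝ) (u : ℕ+ → ℝ) (i : ℕ+) : ℝ :=
  (∑ j ∈ Finset.Iio i, K j (i - j) * u j * u (i - j)) - 2 * ∑' j : ℕ+, K i j * u i * u j

/-- The operator
`- ∑_{j=1}^{i-1} K(i-j, j) u_i u_j + ∑_{j=i+1}^∞ K(j-i, i) u_i u_j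
  + ∑_{j=i+1}^∞ K(i, j-i) u_j u_{j-i}`.
The two infinite sums are indexed by `m = j - i ≥ 1`. -/
noncomputable def fragmentation (K : ℕ+ → ℕ+ → ℝ) (u : ℕ+ → ℝ) (i : ℕ+) : ℝ :=
  -(∑ j ∈ Finset.Iio i, K (i - j) j * u i * u j)
    + (∑' m : ℕ+, K m i * u i * u (i + m))
    + ∑' m : ℕ+, K i m * u (i + m) * u m

/-- The full right-hand side `O = S⁽¹⁾ + S⁽²⁾ + S⁽³⁾ - V`, with `V_i[u] = (i h) ^ δ u_i`. The indices
`0, 1, 2 : Fin 3` stand for the kernels `K₁, K₂, K₃`. -/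
noncomputable def rhs (h : ℝ) (α β : Fin 3 → ℝ) (δ : ℝ) (u : ℕ+ → ℝ) (i : ℕ+) : ℝ :=
  coagulation (kernel h (α 0) (β 0)) u i
    + fragmentation (kernel h (α 1) (β 1)) u i
    + fragmentation (kernel h (α 2) (β 2)) u i
    - loc h i ^ δ * u i

/-- `f` is a classical solution on `[0, ∞)` of `∂f/∂t = O[f]` with initial datum `f₀`. -/
structure IsClassicalSolution (h : ℝ) (α β : Fin 3 → ℝ) (δ : ℝ) (f₀ : ℕ+ → ℝ)
    (f : ℝ → lp (fun _ : ℕ+ => ℝ) 1) : Prop where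
  /-- `f ∈ C¹([0, ∞); ℓ¹)`, with a one-sided derivative at `0`. -/
  contDiffOn : ContDiffOn ℝ 1 f (Set.Ici 0)
  /-- The dissipation `V[f(t)]` lies in `ℓ¹`, with a norm that is bounded for `t` in bounded
  intervals. Under the standing assumptions on the parameters it makes all the series in the
  equation absolutely convergent. -/
  moment_bdd : ∀ T : ℝ, ∃ M : ℝ, ∀ t ∈ Set.Icc 0 T, moment h δ (f t) ≤ ENNReal.ofReal M
  /-- The equation holds for every time `t ≥ 0`, in every component. -/
  eqn : ∀ t : ℝ, 0 ≤ t → ∀ i : ℕ+, derivWithin f (Set.Ici 0) t i = rhs h α β δ (f t) i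
  /-- The initial condition. -/
  init : ∀ i : ℕ+, f 0 i = f₀ i

end ThreeWave

/-!
The proof rests on one Grönwall estimate, which gives nonnegativity and the location of the support
together, and on a comparison argument for each component, which gives positivity.

Let `L` be a set of indices that is closed under sums and positive differences and contains the
support of the initial datum. The `defect` of a state measures, in each component, the distance from
`[0, ∞)` inside `L` and from `{0}` outside `L`. A product `u j * u k` that feeds the component `i`
pushes it in the forbidden direction by at most `defect j * |u k| + |u j| * defect k`
(`defectSlope_mul_mul_le`), as `i ∉ L` forces `j ∉ L` or `k ∉ L`. The kernels are
dominated by products of weights `(1 + i h) ^ γ` with `γ < δ` (`isDominated_kernel`), so the total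
production of defect is at most a constant times the `γ`-weighted total defect; the constant comes
from the bound on the moment of order `δ`. The damping `-(i h) ^ δ f i` absorbs the growth of
the weight (`exists_mul_weight_le`), and what remains is a multiple of the plain total defect
(`tsum_defectSlope_mul_rhs_le`). The total defect starts from `0` and hence stays `0`
(`tsum_defect_eq_zero`). With `L` the multiples of the gcd, this is the vanishing statement; with
`L` the whole index set, it is nonnegativity.

Once `f ≥ 0`, each component satisfies `f i' ≥ G i - q f i` with a gain `G i ≥ 0` and a constant `q`
on bounded time intervals, so that it is positive at all positive times if it is positive initially
or if `G i > 0` (`pos_of_sub_mul_le_deriv`). The coagulation gain contains `f j * f k` for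
`j + k = i`, and the fragmentation gain contains `f (i + m) * f m`. The set of components that are
positive at all positive times is therefore closed under sums and positive differences, and such a
set contains all multiples of the gcd of its elements (`mem_of_setGcd_dvd`).
-/

namespace ThreeWave

/-! ### The weight and the kernels -/

/-- The weight `(1 + i h) ^ γ` on the mesh points. The `1 +` makes the weight at least `1` and
submultiplicative, whatever the mesh size `h`. -/
noncomputable def weight (h γ : ℝ) (i : ℕ+) : ℝ := (1 + loc h i) ^ γ

/-- The kernel `K` is dominated by the weight `ω`: `K i j` is at most the product of the weights of
two members of the triad `i, j, i + j`, whether these are `i, j` or `i + j, j`. These are the two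
kinds of products of amplitudes which `K` multiplies in the equation. -/
structure IsDominated (K : ℕ+ → ℕ+ → ℝ) (ω : ℕ+ → ℝ) : Prop where
  nonneg : ∀ i j, 0 ≤ K i j
  le_mul : ∀ i j, K i j ≤ ω i * ω j
  le_add_mul_right : ∀ i j, K i j ≤ ω (i + j) * ω j

section Weight

variable {h γ : ℝ}

lemma loc_pos (hh : 0 < h) (i : ℕ+) : 0 < loc h i :=
  mul_pos (by exact_mod_cast i.pos) hh

lemma le_loc (hh : 0 < h) (i : ℕ+) : h ≤ loc h i :=
  le_mul_of_one_le_left hh.le (by exact_mod_cast (one_le : 1 ≤ i))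

lemma loc_add (h : ℝ) (i j : ℕ+) : loc h (i + j) = loc h i + loc h j := by
  simp [loc, add_mul]

lemma weight_pos (hh : 0 < h) (i : ℕ+) : 0 < weight h γ i :=
  Real.rpow_pos_of_pos (by linarith [loc_pos hh i]) _

lemma kernel_pos (hh : 0 < h) (a b : ℝ) (i j : ℕ+) : 0 < kernel h a b i j := by
  have hi := loc_pos hh i
  have hj := loc_pos hh j
  unfold kernel
  positivity

lemma kernel_le_add_mul (hh : 0 < h) {a b : ℝ} (ha : 0 ≤ a) (hb : 0 ≤ b) (hab : a + b ≤ γ)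
    (i j : ℕ+) : kernel h a b i j ≤ weight h γ (i + j) * weight h γ j := by
  have hi := loc_pos hh i
  have hj := loc_pos hh j
  unfold kernel weight
  rw [loc_add]
  set x := loc h i
  set y := loc h j
  calc x ^ a * y ^ a * (x + y) ^ b
      ≤ (1 + (x + y)) ^ a * (1 + y) ^ a * (1 + (x + y)) ^ b := by
        gcongr ?_ ^ a * ?_ ^ a * ?_ ^ b <;> linarith
    _ = (1 + (x + y)) ^ (a + b) * (1 + y) ^ a := by
        rw [Real.rpow_add (by positivity)]; ring
    _ ≤ (1 + (x + y)) ^ γ * (1 + y) ^ γ :=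
        mul_le_mul (Real.rpow_le_rpow_of_exponent_le (by linarith) hab)
          (Real.rpow_le_rpow_of_exponent_le (by linarith) (by linarith))
          (by positivity) (by positivity)

lemma isDominated_kernel (hh : 0 < h) {a b : ℝ} (ha : 0 ≤ a) (hb : 0 ≤ b) (hab : a + b ≤ γ) :
    IsDominated (kernel h a b) (weight h γ) where
  nonneg i j := (kernel_pos hh a b i j).le
  le_mul i j := by
    have hi := loc_pos hh i
    have hj := loc_pos hh j
    unfold kernel weight
    set x := loc h i
    set y := loc h j
    calc x ^ a * y ^ a * (x + y) ^ b
        ≤ (1 + x) ^ a * (1 + y) ^ a * ((1 + x) * (1 + y)) ^ b := by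
          gcongr
          · linarith
          · linarith
          · nlinarith [mul_pos hi hj]
      _ = (1 + x) ^ (a + b) * (1 + y) ^ (a + b) := by
          rw [Real.rpow_add (by positivity), Real.rpow_add (by positivity),
            Real.mul_rpow (by positivity) (by positivity)]
          ring
      _ ≤ (1 + x) ^ γ * (1 + y) ^ γ :=
          mul_le_mul (Real.rpow_le_rpow_of_exponent_le (by linarith) hab)
            (Real.rpow_le_rpow_of_exponent_le (by linarith) hab)
            (by positivity) (by positivity)
  le_add_mul_right i j := kernel_le_add_mul hh ha hb hab i j

lemma weight_le_mul_loc_rpow (hh : 0 < h) (hγ : 0 ≤ γ) (i : ℕ+) :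
    weight h γ i ≤ (h⁻¹ + 1) ^ γ * loc h i ^ γ := by
  have hi := loc_pos hh i
  rw [← Real.mul_rpow (by positivity) hi.le]
  refine Real.rpow_le_rpow (by positivity) ?_ hγ
  have : 1 ≤ h⁻¹ * loc h i := by
    rw [inv_mul_eq_div, one_le_div hh]
    exact le_loc hh i
  linarith

/-- The damping rate `(i h) ^ δ` absorbs any multiple of a weight of smaller exponent, up to a
constant. -/
lemma exists_mul_weight_le (hh : 0 < h) {δ : ℝ} (hγ : 0 ≤ γ) (hγδ : γ < δ) {C : ℝ} (hC : 0 ≤ C) :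
    ∃ C', ∀ i, C * weight h γ i ≤ loc h i ^ δ + C' := by
  set B := C * (h⁻¹ + 1) ^ γ
  have hB : 0 ≤ B := by positivity
  have hδγ : 0 < δ - γ := sub_pos.2 hγδ
  refine ⟨B * (B ^ (δ - γ)⁻¹) ^ γ, fun i => ?_⟩
  have hi := loc_pos hh i
  have h1 : C * weight h γ i ≤ B * loc h i ^ γ := by
    rw [mul_assoc]
    exact mul_le_mul_of_nonneg_left (weight_le_mul_loc_rpow hh hγ i) hC
  refine h1.trans ?_
  rcases le_total (B ^ (δ - γ)⁻¹) (loc h i) with hx | hx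
  · have h2 : B ≤ loc h i ^ (δ - γ) := by
      have := Real.rpow_le_rpow (by positivity) hx hδγ.le
      rwa [Real.rpow_inv_rpow hB hδγ.ne'] at this
    have h3 : B * loc h i ^ γ ≤ loc h i ^ δ := by
      calc B * loc h i ^ γ ≤ loc h i ^ (δ - γ) * loc h i ^ γ := by gcongr
        _ = loc h i ^ δ := by rw [← Real.rpow_add hi]; ring_nf
    exact h3.trans (le_add_of_nonneg_right (by positivity))
  · have h2 : B * loc h i ^ γ ≤ B * (B ^ (δ - γ)⁻¹) ^ γ := by gcongr
    exact h2.trans (le_add_of_nonneg_left (by positivity))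

end Weight

/-- A finite moment of order `δ` bounds the sums with the weight of any exponent `γ ≤ δ`. -/
lemma summable_of_moment_le {h γ δ M : ℝ} (hh : 0 < h) (hγ : 0 ≤ γ) (hγδ : γ ≤ δ) {u : ℕ+ → ℝ}
    (hu : moment h δ u ≤ ENNReal.ofReal M) :
    Summable (fun i => loc h i ^ δ * |u i|) ∧ Summable (fun i => weight h γ i * |u i|) ∧
      ∑' i, weight h γ i * |u i| ≤ (h⁻¹ + 1) ^ δ * max M 0 := by
  have h0 : ∀ i, 0 ≤ |u i| * loc h i ^ δ := fun i => by
    have := loc_pos hh i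
    positivity
  have hs : Summable (fun i => |u i| * loc h i ^ δ) := by
    have : ∑' i, ENNReal.ofReal (|u i| * loc h i ^ δ) ≠ ⊤ :=
      ne_top_of_le_ne_top ENNReal.ofReal_ne_top hu
    have := ENNReal.summable_toReal this
    simpa only [ENNReal.toReal_ofReal (h0 _)] using this
  have ht : ∑' i, |u i| * loc h i ^ δ ≤ max M 0 := by
    unfold moment at hu
    rw [← ENNReal.ofReal_tsum_of_nonneg h0 hs, ENNReal.ofReal_le_ofReal_iff'] at hu
    rcases hu with hu | hu
    · exact hu.trans (le_max_left _ _)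
    · exact hu.trans (le_max_right _ _)
  have hle : ∀ i, weight h γ i * |u i| ≤ (h⁻¹ + 1) ^ δ * (|u i| * loc h i ^ δ) := fun i => by
    have hi := loc_pos hh i
    have h1 : weight h γ i ≤ weight h δ i :=
      Real.rpow_le_rpow_of_exponent_le (by linarith) hγδ
    have h2 := h1.trans (weight_le_mul_loc_rpow hh (hγ.trans hγδ) i)
    calc weight h γ i * |u i| ≤ (h⁻¹ + 1) ^ δ * loc h i ^ δ * |u i| := by gcongr
      _ = _ := by ring
  have hs' : Summable (fun i => weight h γ i * |u i|) :=
    Summable.of_nonneg_of_le (fun i => by have := weight_pos (γ := γ) hh i; positivity) hle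
      (hs.mul_left _)
  refine ⟨by simpa only [mul_comm] using hs, hs', ?_⟩
  calc ∑' i, weight h γ i * |u i| ≤ ∑' i, (h⁻¹ + 1) ^ δ * (|u i| * loc h i ^ δ) :=
        hs'.tsum_le_tsum hle (hs.mul_left _)
    _ = (h⁻¹ + 1) ^ δ * ∑' i, |u i| * loc h i ^ δ := tsum_mul_left
    _ ≤ _ := by gcongr

/-! ### Convolution and correlation of summable families -/

section Convolution

variable {f g : ℕ+ → ℝ}

lemma summable_convolution (hf : Summable f) (hg : Summable g) (hf0 : ∀ i, 0 ≤ f i)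
    (hg0 : ∀ i, 0 ≤ g i) :
    Summable (fun i => ∑ j ∈ Finset.Iio i, f j * g (i - j)) ∧
      ∑' i, ∑ j ∈ Finset.Iio i, f j * g (i - j) ≤ (∑' i, f i) * ∑' i, g i := by
  have hfg : Summable (fun p : ℕ+ × ℕ+ => f p.1 * g p.2) := hf.mul_of_nonneg hg hf0 hg0
  let e : (Σ i : ℕ+, Finset.Iio i) → ℕ+ × ℕ+ := fun p => (p.2.1, p.1 - p.2.1)
  have he : Function.Injective e := by
    rintro ⟨i, j, hj⟩ ⟨i', j', hj'⟩ hp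
    simp only [e, Prod.mk.injEq] at hp
    obtain ⟨rfl, hp⟩ := hp
    have h1 := PNat.add_sub_of_lt (Finset.mem_Iio.1 hj)
    rw [hp, PNat.add_sub_of_lt (Finset.mem_Iio.1 hj')] at h1
    subst h1
    rfl
  have hs := hfg.comp_injective he
  have hfib : ∀ i, ∑' j : Finset.Iio i, ((fun p : ℕ+ × ℕ+ => f p.1 * g p.2) ∘ e) ⟨i, j⟩
      = ∑ j ∈ Finset.Iio i, f j * g (i - j) := fun i => by
    rw [tsum_fintype, ← Finset.sum_coe_sort (Finset.Iio i)]
    rfl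
  have h1 := hs.sigma
  simp only [hfib] at h1
  refine ⟨h1, ?_⟩
  simp only [← hfib]
  rw [← hs.tsum_sigma, hf.tsum_mul_tsum hg hfg]
  exact tsum_comp_le_tsum_of_inj hfg (fun p => mul_nonneg (hf0 _) (hg0 _)) he

lemma summable_correlation (hf : Summable f) (hg : Summable g) (hf0 : ∀ i, 0 ≤ f i)
    (hg0 : ∀ i, 0 ≤ g i) :
    (∀ i, Summable fun m => f (i + m) * g m) ∧
      Summable (fun i => ∑' m, f (i + m) * g m) ∧
      ∑' i, ∑' m, f (i + m) * g m ≤ (∑' i, f i) * ∑' i, g i := by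
  have hfg : Summable (fun p : ℕ+ × ℕ+ => f p.1 * g p.2) := hf.mul_of_nonneg hg hf0 hg0
  let e : ℕ+ × ℕ+ → ℕ+ × ℕ+ := fun p => (p.1 + p.2, p.2)
  have he : Function.Injective e := by
    rintro ⟨i, j⟩ ⟨i', j'⟩ hp
    simp only [e, Prod.mk.injEq] at hp
    obtain ⟨hp, rfl⟩ := hp
    simpa using hp
  have hs := hfg.comp_injective he
  refine ⟨fun i => hs.prod_factor i, hs.prod, ?_⟩
  rw [hf.tsum_mul_tsum hg hfg]
  refine (hs.tsum_prod).symm.le.trans ?_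
  exact tsum_comp_le_tsum_of_inj hfg (fun p => mul_nonneg (hf0 _) (hg0 _)) he

end Convolution

/-! ### Bounds for the loss terms and the gain terms -/

section Terms

variable {K : ℕ+ → ℕ+ → ℝ} {ω u : ℕ+ → ℝ}

lemma abs_mul_mul_le {k a b x y : ℝ} (hk0 : 0 ≤ k) (hk : k ≤ a * b) :
    |k * x * y| ≤ (a * |x|) * (b * |y|) := by
  rw [abs_mul, abs_mul, abs_of_nonneg hk0]
  calc k * |x| * |y| ≤ a * b * |x| * |y| := by gcongr
    _ = _ := by ring

lemma abs_tsum_mul_le_of_le (hω : ∀ i, 0 ≤ ω i) (hu : Summable fun i => ω i * |u i|) {c : ℝ}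
    (hc : 0 ≤ c) {e : ℕ+ → ℕ+} (he : Function.Injective e) {F : ℕ+ → ℝ}
    (hF : ∀ m, |F m| ≤ c * (ω (e m) * |u (e m)|)) :
    |∑' m, F m| ≤ c * ∑' j, ω j * |u j| := by
  have hs : Summable fun m => c * (ω (e m) * |u (e m)|) := (hu.comp_injective he).mul_left c
  have h1 : ‖∑' m, F m‖ ≤ ∑' m, c * (ω (e m) * |u (e m)|) :=
    tsum_of_norm_bounded hs.hasSum hF
  rw [tsum_mul_left] at h1
  refine h1.trans (mul_le_mul_of_nonneg_left ?_ hc)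
  exact tsum_comp_le_tsum_of_inj hu (fun i => mul_nonneg (hω i) (abs_nonneg _)) he

lemma abs_coagulation_loss_le (hK : IsDominated K ω) (hω : ∀ i, 0 ≤ ω i)
    (hu : Summable fun i => ω i * |u i|) (i : ℕ+) :
    |∑' j, K i j * u i * u j| ≤ ω i * |u i| * ∑' j, ω j * |u j| :=
  abs_tsum_mul_le_of_le hω hu (mul_nonneg (hω i) (abs_nonneg _)) Function.injective_id
    fun j => abs_mul_mul_le (hK.nonneg i j) (hK.le_mul i j)

lemma abs_fragmentation_loss_le (hK : IsDominated K ω) (hω : ∀ i, 0 ≤ ω i)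
    (hu : Summable fun i => ω i * |u i|) (i : ℕ+) :
    |∑ j ∈ Finset.Iio i, K (i - j) j * u i * u j| ≤ ω i * |u i| * ∑' j, ω j * |u j| := by
  refine (Finset.abs_sum_le_sum_abs _ _).trans ?_
  calc ∑ j ∈ Finset.Iio i, |K (i - j) j * u i * u j|
      ≤ ∑ j ∈ Finset.Iio i, ω i * |u i| * (ω j * |u j|) := by
        refine Finset.sum_le_sum fun j hj => abs_mul_mul_le (hK.nonneg _ _) ?_
        have := hK.le_add_mul_right (i - j) j
        rwa [PNat.sub_add_of_lt (Finset.mem_Iio.1 hj)] at this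
    _ = ω i * |u i| * ∑ j ∈ Finset.Iio i, ω j * |u j| := by rw [Finset.mul_sum]
    _ ≤ _ := by
        refine mul_le_mul_of_nonneg_left ?_ (mul_nonneg (hω i) (abs_nonneg _))
        exact hu.sum_le_tsum _ fun j _ => mul_nonneg (hω j) (abs_nonneg _)

lemma abs_fragmentation_gain_le (hK : IsDominated K ω) (hω : ∀ i, 0 ≤ ω i)
    (hu : Summable fun i => ω i * |u i|) (i : ℕ+) :
    |∑' m, K m i * u i * u (i + m)| ≤ ω i * |u i| * ∑' j, ω j * |u j| := by
  refine abs_tsum_mul_le_of_le hω hu (mul_nonneg (hω i) (abs_nonneg _))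
    (add_right_injective i) fun m => abs_mul_mul_le (hK.nonneg m i) ?_
  have := hK.le_add_mul_right m i
  rwa [add_comm m, mul_comm] at this

lemma summable_fragmentation_gain (hK : IsDominated K ω) (hω : ∀ i, 0 ≤ ω i)
    (hu : Summable fun i => ω i * |u i|) (i : ℕ+) :
    Summable fun m => K i m * u (i + m) * u m := by
  have h0 : ∀ i, 0 ≤ ω i * |u i| := fun i => mul_nonneg (hω i) (abs_nonneg _)
  exact Summable.of_norm_bounded ((summable_correlation hu hu h0 h0).1 i)
    fun m => abs_mul_mul_le (hK.nonneg i m) (hK.le_add_mul_right i m)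

end Terms

/-! ### The defect of a state -/

section Defect

variable {L : Set ℕ+} {u : ℕ+ → ℝ} {i j k : ℕ+}

open Classical in
/-- The distance of `u i` from the set of admissible values, which is `[0, ∞)` for `i ∈ L` and `{0}`
for `i ∉ L`. -/
noncomputable def defect (L : Set ℕ+) (u : ℕ+ → ℝ) (i : ℕ+) : ℝ :=
  if i ∈ L then max (-u i) 0 else |u i|

open Classical in
/-- A subgradient of the convex function `defect L · i` at `u`; it is chosen to vanish wherever the
defect does. -/
noncomputable def defectSlope (L : Set ℕ+) (u : ℕ+ → ℝ) (i : ℕ+) : ℝ :=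
  if u i < 0 then -1 else if i ∈ L ∨ u i = 0 then 0 else 1

lemma defect_nonneg (L : Set ℕ+) (u : ℕ+ → ℝ) (i : ℕ+) : 0 ≤ defect L u i := by
  unfold defect
  split_ifs <;> positivity

lemma defect_le_abs (L : Set ℕ+) (u : ℕ+ → ℝ) (i : ℕ+) : defect L u i ≤ |u i| := by
  unfold defect
  split_ifs
  · exact max_le (neg_le_abs _) (abs_nonneg _)
  · exact le_rfl

lemma neg_le_defect (L : Set ℕ+) (u : ℕ+ → ℝ) (i : ℕ+) : -u i ≤ defect L u i := by
  unfold defect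
  split_ifs
  · exact le_max_left _ _
  · exact neg_le_abs _

lemma defect_of_notMem (hi : i ∉ L) : defect L u i = |u i| := if_neg hi

lemma nonneg_of_defect_eq_zero (h : defect L u i = 0) : 0 ≤ u i := by
  linarith [neg_le_defect L u i]

lemma abs_defectSlope_le_one (L : Set ℕ+) (u : ℕ+ → ℝ) (i : ℕ+) : |defectSlope L u i| ≤ 1 := by
  unfold defectSlope
  split_ifs <;> simp

lemma defectSlope_nonpos (hi : i ∈ L) : defectSlope L u i ≤ 0 := by
  unfold defectSlope
  split_ifs with h1 h2 <;> simp_all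

lemma defectSlope_mul_self (L : Set ℕ+) (u : ℕ+ → ℝ) (i : ℕ+) :
    defectSlope L u i * u i = defect L u i := by
  unfold defectSlope defect
  split_ifs with h1 h2 h3 h3 h3
  · rw [max_eq_left (by linarith)]; ring
  · rw [abs_of_neg h1]; ring
  · rw [max_eq_right (by linarith)]; ring
  · simp_all
  · simp_all
  · rw [abs_of_nonneg (not_lt.1 h1)]; ring

lemma defect_sub_defect_le (L : Set ℕ+) (u v : ℕ+ → ℝ) (i : ℕ+) :
    defect L u i - defect L v i ≤ defectSlope L u i * (u i - v i) := by
  have h1 : defectSlope L u i * v i ≤ defect L v i := by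
    unfold defectSlope defect
    split_ifs with h1 h2 h3 h3 h3
    · simp
    · simpa using neg_le_abs (v i)
    · simp
    · simp
    · simp_all
    · simpa using le_abs_self (v i)
  rw [mul_sub, defectSlope_mul_self]
  linarith

lemma defectSlope_mul_le (L : Set ℕ+) (x : ℝ) : defectSlope L u i * x ≤ |x| := by
  refine (le_abs_self _).trans ?_
  rw [abs_mul]
  exact mul_le_of_le_one_left (abs_nonneg x) (abs_defectSlope_le_one L u i)

/-- An interaction of `j` and `k` that feeds `i` increases the defect at `i` only in proportion to
the defects at `j` and `k`, provided that `L` is closed under this interaction. This covers at once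
that positive amplitudes have positive products, and that an interaction can only leave `L` if it
starts outside `L`. -/
lemma defectSlope_mul_mul_le (hL : j ∈ L → k ∈ L → i ∈ L) :
    defectSlope L u i * (u j * u k) ≤ defect L u j * |u k| + |u j| * defect L u k := by
  have hj := defect_nonneg L u j
  have hk := defect_nonneg L u k
  by_cases hi : i ∈ L
  · have h0 : 0 ≤ defect L u j * |u k| + |u j| * defect L u k := by positivity
    have h1 : -(u j * u k) ≤ defect L u j * |u k| + |u j| * defect L u k := by
      have hj' := neg_le_defect L u j
      have hk' := neg_le_defect L u k
      rcases le_total 0 (u j) with h2 | h2 <;> rcases le_total 0 (u k) with h3 | h3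
      · nlinarith [mul_nonneg h2 h3]
      · rw [abs_of_nonneg h2, abs_of_nonpos h3]
        nlinarith
      · rw [abs_of_nonneg h3, abs_of_nonpos h2]
        nlinarith
      · nlinarith [mul_nonneg_of_nonpos_of_nonpos h2 h3]
    have h2 := defectSlope_nonpos (u := u) hi
    have h3 := (abs_le.1 (abs_defectSlope_le_one L u i)).1
    nlinarith
  · refine (defectSlope_mul_le L _).trans ?_
    rw [abs_mul]
    by_cases hj' : j ∈ L
    · have hk' : k ∉ L := fun h => hi (hL hj' h)
      rw [defect_of_notMem hk']
      exact le_add_of_nonneg_left (by positivity)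
    · rw [defect_of_notMem hj']
      exact le_add_of_nonneg_right (by positivity)

/-- The kernel-weighted form of `defectSlope_mul_mul_le`. -/
lemma defectSlope_mul_kernel_le (hL : j ∈ L → k ∈ L → i ∈ L) {κ a b : ℝ} (hκ0 : 0 ≤ κ)
    (hκ : κ ≤ a * b) :
    defectSlope L u i * (κ * u j * u k) ≤
      (a * defect L u j) * (b * |u k|) + (a * |u j|) * (b * defect L u k) := by
  have hj := defect_nonneg L u j
  have hk := defect_nonneg L u k
  calc defectSlope L u i * (κ * u j * u k) = κ * (defectSlope L u i * (u j * u k)) := by ring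
    _ ≤ κ * (defect L u j * |u k| + |u j| * defect L u k) := by
        gcongr
        exact defectSlope_mul_mul_le hL
    _ ≤ a * b * (defect L u j * |u k| + |u j| * defect L u k) := by gcongr
    _ = _ := by ring

lemma defectSlope_mul_le_of_abs_le {S c X : ℝ} (hS : |S| ≤ c * |u i| * X) :
    defectSlope L u i * S ≤ c * defect L u i * X := by
  by_cases hi : defectSlope L u i = 0
  · have h1 := defectSlope_mul_self L u i
    rw [hi, zero_mul] at h1
    simp [hi, ← h1]
  · have h1 : defect L u i = |u i| := by
      rw [← defectSlope_mul_self]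
      unfold defectSlope at hi ⊢
      split_ifs at hi ⊢ with h1 h2
      · rw [abs_of_neg h1]; ring
      · simp at hi
      · rw [abs_of_nonneg (not_lt.1 h1)]; ring
    rw [h1]
    exact (defectSlope_mul_le L _).trans hS

end Defect

/-! ### The production of defect -/

section Production

variable {L : Set ℕ+} {K : ℕ+ → ℕ+ → ℝ} {ω u : ℕ+ → ℝ}

/-- An upper bound for the production of defect at `i` by the coagulation gain term. -/
noncomputable def coagulationProduction (L : Set ℕ+) (ω u : ℕ+ → ℝ) (i : ℕ+) : ℝ :=
  (∑ j ∈ Finset.Iio i, (ω j * defect L u j) * (ω (i - j) * |u (i - j)|)) +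
    ∑ j ∈ Finset.Iio i, (ω j * |u j|) * (ω (i - j) * defect L u (i - j))

/-- An upper bound for the production of defect at `i` by the second fragmentation gain term. -/
noncomputable def fragmentationProduction (L : Set ℕ+) (ω u : ℕ+ → ℝ) (i : ℕ+) : ℝ :=
  (∑' m, (ω (i + m) * defect L u (i + m)) * (ω m * |u m|)) +
    ∑' m, (ω (i + m) * |u (i + m)|) * (ω m * defect L u m)

lemma summable_weight_mul_defect (hω : ∀ i, 0 ≤ ω i) (hu : Summable fun i => ω i * |u i|) :
    Summable fun i => ω i * defect L u i :=
  Summable.of_nonneg_of_le (fun i => mul_nonneg (hω i) (defect_nonneg L u i))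
    (fun i => mul_le_mul_of_nonneg_left (defect_le_abs L u i) (hω i)) hu

lemma summable_coagulationProduction (hω : ∀ i, 0 ≤ ω i) (hu : Summable fun i => ω i * |u i|) :
    Summable (coagulationProduction L ω u) ∧ ∑' i, coagulationProduction L ω u i ≤
      2 * (∑' i, ω i * |u i|) * ∑' i, ω i * defect L u i := by
  have hA0 : ∀ i, 0 ≤ ω i * |u i| := fun i => mul_nonneg (hω i) (abs_nonneg _)
  have hZ0 : ∀ i, 0 ≤ ω i * defect L u i := fun i => mul_nonneg (hω i) (defect_nonneg L u i)
  have hZ := summable_weight_mul_defect (L := L) hω hu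
  obtain ⟨h1, h1'⟩ := summable_convolution hZ hu hZ0 hA0
  obtain ⟨h2, h2'⟩ := summable_convolution hu hZ hA0 hZ0
  refine ⟨h1.add h2, ?_⟩
  unfold coagulationProduction
  rw [h1.tsum_add h2]
  linarith

lemma summable_fragmentationProduction (hω : ∀ i, 0 ≤ ω i) (hu : Summable fun i => ω i * |u i|) :
    Summable (fragmentationProduction L ω u) ∧ ∑' i, fragmentationProduction L ω u i ≤
      2 * (∑' i, ω i * |u i|) * ∑' i, ω i * defect L u i := by
  have hA0 : ∀ i, 0 ≤ ω i * |u i| := fun i => mul_nonneg (hω i) (abs_nonneg _)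
  have hZ0 : ∀ i, 0 ≤ ω i * defect L u i := fun i => mul_nonneg (hω i) (defect_nonneg L u i)
  have hZ := summable_weight_mul_defect (L := L) hω hu
  obtain ⟨-, h1, h1'⟩ := summable_correlation hZ hu hZ0 hA0
  obtain ⟨-, h2, h2'⟩ := summable_correlation hu hZ hA0 hZ0
  refine ⟨h1.add h2, ?_⟩
  unfold fragmentationProduction
  rw [h1.tsum_add h2]
  linarith

lemma defectSlope_mul_coagulation_le (hK : IsDominated K ω) (hω : ∀ i, 0 ≤ ω i)
    (hu : Summable fun i => ω i * |u i|) (hL : ∀ i j, i ∈ L → j ∈ L → i + j ∈ L) (i : ℕ+) :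
    defectSlope L u i * coagulation K u i ≤
      coagulationProduction L ω u i + 2 * (ω i * defect L u i * ∑' j, ω j * |u j|) := by
  have hgain : defectSlope L u i * ∑ j ∈ Finset.Iio i, K j (i - j) * u j * u (i - j) ≤
      coagulationProduction L ω u i := by
    unfold coagulationProduction
    rw [Finset.mul_sum, ← Finset.sum_add_distrib]
    refine Finset.sum_le_sum fun j hj => ?_
    refine defectSlope_mul_kernel_le (fun h1 h2 => ?_) (hK.nonneg _ _) (hK.le_mul _ _)
    have := hL _ _ h1 h2
    rwa [PNat.add_sub_of_lt (Finset.mem_Iio.1 hj)] at this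
  have hloss := defectSlope_mul_le_of_abs_le (L := L) (u := u) (i := i)
    ((abs_neg _).trans_le (abs_coagulation_loss_le hK hω hu i))
  unfold coagulation
  rw [mul_sub]
  linarith

lemma defectSlope_mul_fragmentation_le (hK : IsDominated K ω) (hω : ∀ i, 0 ≤ ω i)
    (hu : Summable fun i => ω i * |u i|) (hL : ∀ i j, i + j ∈ L → j ∈ L → i ∈ L) (i : ℕ+) :
    defectSlope L u i * fragmentation K u i ≤
      fragmentationProduction L ω u i + 2 * (ω i * defect L u i * ∑' j, ω j * |u j|) := by
  have hA0 : ∀ i, 0 ≤ ω i * |u i| := fun i => mul_nonneg (hω i) (abs_nonneg _)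
  have hZ0 : ∀ i, 0 ≤ ω i * defect L u i := fun i => mul_nonneg (hω i) (defect_nonneg L u i)
  have hZ := summable_weight_mul_defect (L := L) hω hu
  have hgain : defectSlope L u i * ∑' m, K i m * u (i + m) * u m ≤
      fragmentationProduction L ω u i := by
    have h1 := (summable_correlation hZ hu hZ0 hA0).1 i
    have h2 := (summable_correlation hu hZ hA0 hZ0).1 i
    unfold fragmentationProduction
    rw [← tsum_mul_left, ← h1.tsum_add h2]
    exact ((summable_fragmentation_gain hK hω hu i).mul_left _).tsum_le_tsum
      (fun m => defectSlope_mul_kernel_le (hL i m) (hK.nonneg _ _) (hK.le_add_mul_right _ _))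
      (h1.add h2)
  have hloss := defectSlope_mul_le_of_abs_le (L := L) (u := u) (i := i)
    ((abs_neg _).trans_le (abs_fragmentation_loss_le hK hω hu i))
  have hgain' := defectSlope_mul_le_of_abs_le (L := L) (u := u) (i := i)
    (abs_fragmentation_gain_le hK hω hu i)
  unfold fragmentation
  rw [mul_add, mul_add]
  linarith

end Production

/-! ### Estimates for the full right-hand side -/

section RHS

variable {h γ δ : ℝ} {α β : Fin 3 → ℝ} {L : Set ℕ+} {u : ℕ+ → ℝ}

/-- The total production of defect is controlled by the total defect: the interactions produce at
most a multiple of the sum of `weight h γ i * defect L u i`, which the damping absorbs up to a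
multiple of the unweighted sum. -/
lemma tsum_defectSlope_mul_rhs_le (hh : 0 < h) (hα : ∀ n, 0 ≤ α n) (hβ : ∀ n, 0 ≤ β n)
    (hγ : ∀ n, α n + β n ≤ γ) (hadd : ∀ i j, i ∈ L → j ∈ L → i + j ∈ L)
    (hsub : ∀ i j, i + j ∈ L → j ∈ L → i ∈ L) (hu : Summable fun i => |u i|)
    (huδ : Summable fun i => loc h i ^ δ * |u i|) (huγ : Summable fun i => weight h γ i * |u i|)
    {X C : ℝ} (hX : ∑' i, weight h γ i * |u i| ≤ X)
    (hC : ∀ i, 12 * X * weight h γ i ≤ loc h i ^ δ + C) {F : ℕ+ → ℝ}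
    (hF : Summable fun i => defectSlope L u i * F i) (hFu : ∀ i, F i = rhs h α β δ u i) :
    ∑' i, defectSlope L u i * F i ≤ C * ∑' i, defect L u i := by
  have hω : ∀ i, 0 ≤ weight h γ i := fun i => (weight_pos hh i).le
  have hK := fun n => isDominated_kernel hh (hα n) (hβ n) (hγ n)
  have hloc : ∀ i, 0 ≤ loc h i ^ δ := fun i => (Real.rpow_pos_of_pos (loc_pos hh i) _).le
  have hZ := summable_weight_mul_defect (L := L) hω huγ
  have hV := summable_weight_mul_defect (L := L) hloc huδ
  have hd : Summable (defect L u) :=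
    Summable.of_nonneg_of_le (defect_nonneg L u) (defect_le_abs L u) hu
  obtain ⟨hc, hc'⟩ := summable_coagulationProduction (L := L) hω huγ
  obtain ⟨hp, hp'⟩ := summable_fragmentationProduction (L := L) hω huγ
  set X₀ := ∑' i, weight h γ i * |u i|
  have hpt : ∀ i, defectSlope L u i * F i ≤ coagulationProduction L (weight h γ) u i +
      2 * fragmentationProduction L (weight h γ) u i + 6 * X₀ * (weight h γ i * defect L u i) -
      loc h i ^ δ * defect L u i := fun i => by
    have h1 := defectSlope_mul_coagulation_le (hK 0) hω huγ hadd i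
    have h2 := defectSlope_mul_fragmentation_le (hK 1) hω huγ hsub i
    have h3 := defectSlope_mul_fragmentation_le (hK 2) hω huγ hsub i
    have h4 := defectSlope_mul_self L u i
    rw [hFu, rhs, ← h4]
    rw [← h4] at h1 h2 h3
    linarith
  have hsum := ((hc.add (hp.mul_left 2)).add (hZ.mul_left (6 * X₀))).sub hV
  refine (hF.tsum_le_tsum hpt hsum).trans ?_
  rw [((hc.add (hp.mul_left 2)).add (hZ.mul_left (6 * X₀))).tsum_sub hV,
    (hc.add (hp.mul_left 2)).tsum_add (hZ.mul_left (6 * X₀)), hc.tsum_add (hp.mul_left 2),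
    tsum_mul_left, tsum_mul_left]
  have hY : 0 ≤ ∑' i, weight h γ i * defect L u i :=
    tsum_nonneg fun i => mul_nonneg (hω i) (defect_nonneg L u i)
  have hfin : 12 * X * ∑' i, weight h γ i * defect L u i ≤
      ∑' i, loc h i ^ δ * defect L u i + C * ∑' i, defect L u i := by
    rw [← tsum_mul_left, ← tsum_mul_left, ← hV.tsum_add (hd.mul_left C)]
    refine (hZ.mul_left _).tsum_le_tsum (fun i => ?_) (hV.add (hd.mul_left C))
    have := mul_le_mul_of_nonneg_right (hC i) (defect_nonneg L u i)
    linarith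
  have hXY := mul_le_mul_of_nonneg_right hX hY
  linarith

/-- For a nonnegative state, each of the nonnegative gain terms, less a loss proportional to `u i`,
bounds the right-hand side from below. -/
lemma le_rhs_of_nonneg (hh : 0 < h) (hα : ∀ n, 0 ≤ α n) (hβ : ∀ n, 0 ≤ β n)
    (hγ : ∀ n, α n + β n ≤ γ) (hu0 : ∀ i, 0 ≤ u i)
    (huγ : Summable fun i => weight h γ i * |u i|) {X : ℝ}
    (hX : ∑' i, weight h γ i * |u i| ≤ X) (i : ℕ+) :
    (∑ j ∈ Finset.Iio i, kernel h (α 0) (β 0) j (i - j) * u j * u (i - j)) +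
        (∑' m, kernel h (α 1) (β 1) i m * u (i + m) * u m) -
        (6 * X * weight h γ i + loc h i ^ δ) * u i ≤ rhs h α β δ u i := by
  have hω : ∀ i, 0 ≤ weight h γ i := fun i => (weight_pos hh i).le
  have hK := fun n => isDominated_kernel hh (hα n) (hβ n) (hγ n)
  have h1 := (abs_le.1 (abs_coagulation_loss_le (hK 0) hω huγ i)).2
  have h2 := (abs_le.1 (abs_fragmentation_loss_le (hK 1) hω huγ i)).2
  have h3 := (abs_le.1 (abs_fragmentation_loss_le (hK 2) hω huγ i)).2
  have h4 := (abs_le.1 (abs_fragmentation_gain_le (hK 1) hω huγ i)).1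
  have h5 := (abs_le.1 (abs_fragmentation_gain_le (hK 2) hω huγ i)).1
  have h6 : 0 ≤ ∑' m, kernel h (α 2) (β 2) i m * u (i + m) * u m :=
    tsum_nonneg fun m => mul_nonneg (mul_nonneg ((hK 2).nonneg _ _) (hu0 _)) (hu0 _)
  have h7 := mul_le_mul_of_nonneg_left hX (mul_nonneg (hω i) (hu0 i))
  rw [abs_of_nonneg (hu0 i)] at h1 h2 h3 h4 h5
  unfold rhs coagulation fragmentation
  linarith

end RHS

/-! ### A Grönwall estimate in `ℓ¹` -/

section Gronwall

variable {L : Set ℕ+}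

lemma hasSum_abs_of_lp_one (u : lp (fun _ : ℕ+ => ℝ) 1) : HasSum (fun i => |u i|) ‖u‖ := by
  simpa using lp.hasSum_norm (p := 1) (by simp) u

lemma summable_defect (u : lp (fun _ : ℕ+ => ℝ) 1) : Summable (defect L u) :=
  Summable.of_nonneg_of_le (defect_nonneg L u) (defect_le_abs L u) (hasSum_abs_of_lp_one u).summable

lemma summable_defectSlope_mul (u : ℕ+ → ℝ) (v : lp (fun _ : ℕ+ => ℝ) 1) :
    Summable fun i => defectSlope L u i * v i := by
  refine Summable.of_norm_bounded (hasSum_abs_of_lp_one v).summable fun i => ?_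
  rw [Real.norm_eq_abs, abs_mul]
  exact mul_le_of_le_one_left (abs_nonneg _) (abs_defectSlope_le_one L u i)

lemma tsum_defectSlope_mul_le_add (u : ℕ+ → ℝ) (v w : lp (fun _ : ℕ+ => ℝ) 1) :
    ∑' i, defectSlope L u i * v i ≤ ∑' i, defectSlope L u i * w i + ‖v - w‖ := by
  have h := hasSum_abs_of_lp_one (v - w)
  rw [← h.tsum_eq, ← (summable_defectSlope_mul u w).tsum_add h.summable]
  refine (summable_defectSlope_mul u v).tsum_le_tsum (fun i => ?_)
    ((summable_defectSlope_mul u w).add h.summable)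
  have := defectSlope_mul_le (u := u) (i := i) L ((v - w) i)
  have h2 : (v - w) i = v i - w i := rfl
  rw [h2, mul_sub] at this
  rw [h2]
  linarith

lemma continuous_tsum_defect :
    Continuous fun u : lp (fun _ : ℕ+ => ℝ) 1 => ∑' i, defect L u i := by
  have key : ∀ u v : lp (fun _ : ℕ+ => ℝ) 1,
      ∑' i, defect L u i ≤ ∑' i, defect L v i + ‖u - v‖ := fun u v => by
    have h := hasSum_abs_of_lp_one (u - v)
    rw [← h.tsum_eq, ← (summable_defect v).tsum_add h.summable]
    refine (summable_defect u).tsum_le_tsum (fun i => ?_) ((summable_defect v).add h.summable)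
    have h1 := defect_sub_defect_le L u v i
    have h2 := defectSlope_mul_le (u := u) (i := i) L (u i - v i)
    have h3 : (u - v) i = u i - v i := rfl
    rw [h3]
    linarith
  refine (LipschitzWith.of_dist_le_mul (K := 1) fun u v => ?_).continuous
  rw [NNReal.coe_one, one_mul, Real.dist_eq, abs_le, dist_eq_norm]
  have h1 := key u v
  have h2 := key v u
  rw [norm_sub_rev] at h2
  constructor <;> linarith

/-- If the total defect of a differentiable curve in `ℓ¹` vanishes initially and its production,
measured by the subgradient, is at most proportional to it, then it vanishes at all later times.

Convexity bounds the *left* difference quotients of the total defect by the subgradient at the right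
end point. Grönwall's inequality is therefore applied to minus the total defect, in reversed time;
there the constant `C` appears as the rate `-C`. -/
lemma tsum_defect_eq_zero {f f' : ℝ → lp (fun _ : ℕ+ => ℝ) 1} {T C : ℝ} (hT : 0 ≤ T)
    (hf : ∀ t ∈ Set.Icc 0 T, HasDerivWithinAt f (f' t) (Set.Icc 0 T) t)
    (hC : ∀ t ∈ Set.Icc 0 T,
      ∑' i, defectSlope L (f t) i * f' t i ≤ C * ∑' i, defect L (f t) i)
    (h0 : ∑' i, defect L (f 0) i = 0) : ∑' i, defect L (f T) i = 0 := by
  set W : ℝ → ℝ := fun t => ∑' i, defect L (f t) i with hW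
  have hmaps : Set.MapsTo (fun s => T - s) (Set.Icc 0 T) (Set.Icc 0 T) := fun s hs =>
    ⟨sub_nonneg.2 hs.2, by linarith [hs.1]⟩
  have hcont : ContinuousOn (fun s => -W (T - s)) (Set.Icc 0 T) := by
    have h1 : ContinuousOn f (Set.Icc 0 T) := fun t ht => (hf t ht).continuousWithinAt
    exact (continuous_tsum_defect.comp_continuousOn (h1.comp (by fun_prop) hmaps)).neg
  have hgr := le_gronwallBound_of_liminf_deriv_right_le (f := fun s => -W (T - s))
    (f' := fun s => C * W (T - s)) (δ := -W T) (K := -C) (ε := 0) (a := 0) (b := T) hcont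
    ?_ (by simp) (fun s _ => le_of_eq (by ring)) T ⟨hT, le_rfl⟩
  · rw [gronwallBound_ε0] at hgr
    have h1 : W 0 = 0 := h0
    simp only [sub_self, h1, sub_zero] at hgr
    have h2 : 0 ≤ W T := tsum_nonneg fun i => defect_nonneg L _ i
    have h3 := Real.exp_pos (-C * T)
    have h4 : W T ≤ 0 := by
      by_contra! h
      nlinarith [mul_pos h h3]
    exact le_antisymm h4 h2
  · intro s hs r hr
    -- The right difference quotients in reversed time are left difference quotients at `T - s`.
    refine Filter.Eventually.frequently ?_
    have hτ := hmaps ⟨hs.1, hs.2.le⟩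
    have hd : HasDerivWithinAt (fun z => f (T - z)) (-f' (T - s)) (Set.Icc 0 T) s := by
      have h1 : HasDerivWithinAt (fun z => T - z) (-1 : ℝ) (Set.Icc 0 T) s := by
        simpa using (hasDerivWithinAt_id s (Set.Icc 0 T)).const_sub T
      have h2 := (hf (T - s) hτ).scomp s h1 hmaps
      rwa [neg_one_smul] at h2
    have hd' : HasDerivWithinAt (fun z => f (T - z)) (-f' (T - s)) (Set.Ioi s) s := by
      refine (hd.mono_of_mem_nhdsWithin ?_)
      exact Filter.mem_of_superset (Ioo_mem_nhdsGT hs.2)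
        fun z hz => ⟨hs.1.trans hz.1.le, hz.2.le⟩
    have hlim := (hasDerivWithinAt_iff_tendsto_slope' (lt_irrefl s)).1 hd'
    have hlim2 : Filter.Tendsto (fun z => ∑' i, defectSlope L (f (T - s)) i * f' (T - s) i +
        ‖-slope (fun z => f (T - z)) s z - f' (T - s)‖) (nhdsWithin s (Set.Ioi s))
        (nhds (∑' i, defectSlope L (f (T - s)) i * f' (T - s) i +
          ‖- -f' (T - s) - f' (T - s)‖)) :=
      (((hlim.neg).sub_const _).norm).const_add _
    rw [neg_neg, sub_self, norm_zero, add_zero] at hlim2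
    have hev := hlim2.eventually (gt_mem_nhds ((hC _ hτ).trans_lt hr))
    filter_upwards [hev, self_mem_nhdsWithin] with z hz hsz
    refine lt_of_le_of_lt ?_ hz
    refine le_trans ?_ (tsum_defectSlope_mul_le_add (f (T - s)) _ _)
    have hzs : 0 < z - s := sub_pos.2 hsz
    have hcoord : ∀ i, (-slope (fun z => f (T - z)) s z) i =
        (z - s)⁻¹ * (f (T - s) i - f (T - z) i) := fun i => by
      have : (-slope (fun z => f (T - z)) s z) i = -((z - s)⁻¹ * (f (T - z) i - f (T - s) i)) := rfl
      rw [this]; ring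
    have hdiff : -W (T - z) - -W (T - s) =
        ∑' i, (defect L (f (T - s)) i - defect L (f (T - z)) i) := by
      rw [(summable_defect _).tsum_sub (summable_defect _)]
      simp only [hW]
      ring
    rw [hdiff, ← tsum_mul_left]
    refine Summable.tsum_le_tsum (fun i => ?_)
      (((summable_defect _).sub (summable_defect _)).mul_left _) (summable_defectSlope_mul _ _)
    rw [hcoord]
    have := mul_le_mul_of_nonneg_left (defect_sub_defect_le L (f (T - s)) (f (T - z)) i)
      (inv_pos.2 hzs).le
    linarith

end Gronwall

/-! ### Positivity of solutions of scalar differential inequalities -/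

/-- A nonnegative function with `g' ≥ -q g` that vanishes at some time has vanished before. -/
lemma eq_zero_of_neg_mul_le_deriv {g g' : ℝ → ℝ} {T q : ℝ}
    (hg : ∀ t ∈ Set.Icc 0 T, HasDerivWithinAt g (g' t) (Set.Icc 0 T) t)
    (hg0 : ∀ t ∈ Set.Icc 0 T, 0 ≤ g t) (hq : ∀ t ∈ Set.Icc 0 T, -(q * g t) ≤ g' t)
    (hT : g T = 0) {s : ℝ} (hs : s ∈ Set.Icc 0 T) : g s = 0 := by
  have hd : ∀ t ∈ Set.Icc 0 T, HasDerivWithinAt (fun t => g t * Real.exp (q * t))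
      (g' t * Real.exp (q * t) + g t * (Real.exp (q * t) * q)) (Set.Icc 0 T) t := fun t ht =>
    (hg t ht).mul (((hasDerivAt_id t).const_mul q |>.congr_deriv (mul_one q)).exp.hasDerivWithinAt)
  have hmono : MonotoneOn (fun t => g t * Real.exp (q * t)) (Set.Icc 0 T) := by
    refine monotoneOn_of_deriv_nonneg (convex_Icc 0 T)
      (fun t ht => (hd t ht).continuousWithinAt)
      (fun t ht => ((hd t (interior_subset ht)).mono interior_subset).differentiableWithinAt)
      fun t ht => ?_
    have ht' := interior_subset ht
    rw [((hd t ht').hasDerivAt (mem_interior_iff_mem_nhds.1 ht)).deriv]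
    have h1 := hq t ht'
    have h2 : 0 ≤ (g' t + q * g t) * Real.exp (q * t) :=
      mul_nonneg (by linarith) (Real.exp_pos _).le
    linarith
  have h1 := hmono hs ⟨hs.1.trans hs.2, le_rfl⟩ hs.2
  simp only [hT, zero_mul] at h1
  have h2 := hg0 s hs
  have h3 := Real.exp_pos (q * s)
  by_contra h
  have h4 : 0 < g s := lt_of_le_of_ne h2 (Ne.symm h)
  linarith [mul_pos h4 h3]

/-- A nonnegative function with `g' ≥ G - q g` is positive at time `T` if it is positive initially or
if the gain `G` is positive. -/
lemma pos_of_sub_mul_le_deriv {g g' G : ℝ → ℝ} {T q : ℝ} (hT : 0 < T)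
    (hg : ∀ t ∈ Set.Icc 0 T, HasDerivWithinAt g (g' t) (Set.Icc 0 T) t)
    (hg0 : ∀ t ∈ Set.Icc 0 T, 0 ≤ g t) (hG0 : ∀ t ∈ Set.Icc 0 T, 0 ≤ G t)
    (hq : ∀ t ∈ Set.Icc 0 T, G t - q * g t ≤ g' t) (h : 0 < g 0 ∨ ∀ t, 0 < t → 0 < G t) :
    0 < g T := by
  refine lt_of_le_of_ne (hg0 T ⟨hT.le, le_rfl⟩) fun hgT => ?_
  have hz : ∀ s ∈ Set.Icc 0 T, g s = 0 := fun s hs =>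
    eq_zero_of_neg_mul_le_deriv (q := q) hg hg0
      (fun t ht => by linarith [hq t ht, hG0 t ht]) hgT.symm hs
  rcases h with h | h
  · exact h.ne' (hz 0 ⟨le_rfl, hT.le⟩)
  · have hmem : T ∈ Set.Icc 0 T := ⟨hT.le, le_rfl⟩
    have h1 : HasDerivWithinAt g 0 (Set.Icc 0 T) T :=
      (hasDerivWithinAt_const T (Set.Icc 0 T) (0 : ℝ)).congr hz (hz T hmem)
    have h2 := (uniqueDiffOn_Icc hT T hmem).eq_deriv _ (hg T hmem) h1
    have h3 := hq T hmem
    rw [h2, hz T hmem] at h3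
    linarith [h T hT]

/-! ### Index sets closed under the interactions -/

/-- A set of positive integers that is closed under addition and under positive differences contains
all multiples of the greatest common divisor of its elements. -/
lemma mem_of_setGcd_dvd {P : Set ℕ+} (hadd : ∀ i j, i ∈ P → j ∈ P → i + j ∈ P)
    (hsub : ∀ i j, i + j ∈ P → j ∈ P → i ∈ P) {S : Set ℕ} (hS : ∀ n ∈ S, ∃ p ∈ P, (p : ℕ) = n)
    {i : ℕ+} (hi : Nat.setGcd S ∣ i) : i ∈ P := by
  have hne : Nat.setGcd S ≠ 0 := fun h => i.ne_zero (Nat.eq_zero_of_zero_dvd (h ▸ hi))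
  obtain ⟨n, hn, -⟩ := Nat.exists_ne_zero_of_setGcd_ne_zero hne
  obtain ⟨p₀, hp₀, -⟩ := hS n hn
  -- The differences of elements of `P` form a subgroup, whose positive elements lie in `P`.
  let H : AddSubgroup ℤ :=
    { carrier := {z | ∃ p ∈ P, ∃ q ∈ P, z = (p : ℕ) - (q : ℕ)}
      zero_mem' := ⟨p₀, hp₀, p₀, hp₀, by simp⟩
      add_mem' := by
        rintro _ _ ⟨p, hp, q, hq, rfl⟩ ⟨p', hp', q', hq', rfl⟩
        refine ⟨p + p', hadd _ _ hp hp', q + q', hadd _ _ hq hq', ?_⟩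
        push_cast
        ring
      neg_mem' := by
        rintro _ ⟨p, hp, q, hq, rfl⟩
        exact ⟨q, hq, p, hp, by ring⟩ }
  have hspan : Ideal.span (((↑) : ℕ → ℤ) '' S) ≤ AddSubgroup.toIntSubmodule H := by
    refine Submodule.span_le.2 ?_
    rintro _ ⟨n, hn, rfl⟩
    obtain ⟨p, hp, rfl⟩ := hS n hn
    exact ⟨p + p, hadd _ _ hp hp, p, hp, by push_cast; ring⟩
  rw [← Nat.span_singleton_setGcd] at hspan
  obtain ⟨p, hp, q, hq, hpq⟩ := hspan (Ideal.mem_span_singleton.2 (Int.natCast_dvd_natCast.2 hi))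
  have hiq : i + q = p := by
    apply PNat.eq
    push_cast
    omega
  exact hsub i q (hiq ▸ hp) hq

/-! ### Classical solutions -/

namespace IsClassicalSolution

variable {h δ : ℝ} {α β : Fin 3 → ℝ} {f₀ : ℕ+ → ℝ} {f : ℝ → lp (fun _ : ℕ+ => ℝ) 1}

lemma hasDerivWithinAt (hf : IsClassicalSolution h α β δ f₀ f) (T : ℝ) :
    ∀ t ∈ Set.Icc 0 T, HasDerivWithinAt f (derivWithin f (Set.Ici 0) t) (Set.Icc 0 T) t :=
  fun t ht => ((hf.contDiffOn.differentiableOn one_ne_zero t ht.1).hasDerivWithinAt).mono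
    Set.Icc_subset_Ici_self

/-- An exponent between the degrees of homogeneity of the kernels and the damping exponent. -/
lemma exists_exponent (hα : ∀ n, 0 ≤ α n) (hβ : ∀ n, 0 ≤ β n) (hδ : ∀ n, α n + β n < δ) :
    ∃ γ, 0 ≤ γ ∧ γ < δ ∧ ∀ n, α n + β n ≤ γ := by
  obtain ⟨n, -, hn⟩ := Finset.univ.exists_max_image (fun n => α n + β n) Finset.univ_nonempty
  exact ⟨α n + β n, add_nonneg (hα n) (hβ n), hδ n, fun m => hn m (Finset.mem_univ m)⟩

/-- On a bounded time interval, the weighted `ℓ¹` norms of the solution are bounded. -/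
lemma exists_weight_bound (hf : IsClassicalSolution h α β δ f₀ f) (hh : 0 < h) {γ : ℝ}
    (hγ : 0 ≤ γ) (hγδ : γ ≤ δ) (T : ℝ) :
    ∃ X, 0 ≤ X ∧ ∀ t ∈ Set.Icc 0 T, Summable (fun i => loc h i ^ δ * |f t i|) ∧
      Summable (fun i => weight h γ i * |f t i|) ∧ ∑' i, weight h γ i * |f t i| ≤ X := by
  obtain ⟨M, hM⟩ := hf.moment_bdd T
  exact ⟨_, by positivity, fun t ht => summable_of_moment_le hh hγ hγδ (hM t ht)⟩

/-- If `L` is closed under the interactions and contains the support of the initial datum, then the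
solution is nonnegative and supported in `L` at all times. -/
lemma defect_eq_zero (hf : IsClassicalSolution h α β δ f₀ f) (hh : 0 < h) (hα : ∀ n, 0 ≤ α n)
    (hβ : ∀ n, 0 ≤ β n) (hδ : ∀ n, α n + β n < δ) (hf₀ : ∀ i, 0 ≤ f₀ i) {L : Set ℕ+}
    (hadd : ∀ i j, i ∈ L → j ∈ L → i + j ∈ L) (hsub : ∀ i j, i + j ∈ L → j ∈ L → i ∈ L)
    (hL : ∀ i, 0 < f₀ i → i ∈ L) {t : ℝ} (ht : 0 ≤ t) (i : ℕ+) : defect L (f t) i = 0 := by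
  obtain ⟨γ, hγ, hγδ, hαβ⟩ := exists_exponent hα hβ hδ
  obtain ⟨X, hX, hb⟩ := hf.exists_weight_bound hh hγ hγδ.le t
  obtain ⟨C, hC⟩ := exists_mul_weight_le hh hγ hγδ (C := 12 * X) (by positivity)
  have h0 : ∑' i, defect L (f 0) i = 0 := by
    have : ∀ i, defect L (f 0) i = 0 := fun i => by
      unfold defect
      rw [hf.init]
      split_ifs with hi
      · simpa using hf₀ i
      · simpa using le_antisymm (not_lt.1 fun h => hi (hL i h)) (hf₀ i)
    simp [this]
  have h1 := tsum_defect_eq_zero (L := L) ht (hf.hasDerivWithinAt t) (C := C) (fun s hs => by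
    obtain ⟨hs1, hs2, hs3⟩ := hb s hs
    exact tsum_defectSlope_mul_rhs_le hh hα hβ hαβ hadd hsub (hasSum_abs_of_lp_one (f s)).summable
      hs1 hs2 hs3 hC (summable_defectSlope_mul _ _) (hf.eqn s hs.1)) h0
  have h2 := (summable_defect (f t)).hasSum_iff.2 h1
  exact congrFun ((hasSum_zero_iff_of_nonneg (defect_nonneg L (f t))).1 h2) i

lemma nonneg (hf : IsClassicalSolution h α β δ f₀ f) (hh : 0 < h) (hα : ∀ n, 0 ≤ α n)
    (hβ : ∀ n, 0 ≤ β n) (hδ : ∀ n, α n + β n < δ) (hf₀ : ∀ i, 0 ≤ f₀ i) {t : ℝ} (ht : 0 ≤ t)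
    (i : ℕ+) : 0 ≤ f t i :=
  nonneg_of_defect_eq_zero (hf.defect_eq_zero hh hα hβ hδ hf₀ (L := Set.univ)
    (fun _ _ _ _ => Set.mem_univ _) (fun _ _ _ _ => Set.mem_univ _) (fun _ _ => Set.mem_univ _)
    ht i)

/-- The component `i` becomes positive at once if it is positive initially, or if one of two gain
terms (that of coagulation, and one of those of the first fragmentation operator) is positive at
positive times. -/
lemma pos_of_gain_pos (hf : IsClassicalSolution h α β δ f₀ f) (hh : 0 < h) (hα : ∀ n, 0 ≤ α n)
    (hβ : ∀ n, 0 ≤ β n) (hδ : ∀ n, α n + β n < δ) (hf₀ : ∀ i, 0 ≤ f₀ i) (i : ℕ+)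
    (hi : 0 < f₀ i ∨ ∀ t, 0 < t →
      0 < (∑ j ∈ Finset.Iio i, kernel h (α 0) (β 0) j (i - j) * f t j * f t (i - j)) +
        ∑' m, kernel h (α 1) (β 1) i m * f t (i + m) * f t m) {t : ℝ} (ht : 0 < t) :
    0 < f t i := by
  obtain ⟨γ, hγ, hγδ, hαβ⟩ := exists_exponent hα hβ hδ
  obtain ⟨X, hX, hb⟩ := hf.exists_weight_bound hh hγ hγδ.le t
  have h0 : ∀ s, 0 ≤ s → ∀ j, 0 ≤ f s j := fun s hs j => hf.nonneg hh hα hβ hδ hf₀ hs j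
  have hd : ∀ s ∈ Set.Icc 0 t, HasDerivWithinAt (fun s => f s i)
      (derivWithin f (Set.Ici 0) s i) (Set.Icc 0 t) s := fun s hs =>
    (lp.evalCLM ℝ (fun _ : ℕ+ => ℝ) 1 i).hasFDerivAt.comp_hasDerivWithinAt s
      (hf.hasDerivWithinAt t s hs)
  refine pos_of_sub_mul_le_deriv (q := 6 * X * weight h γ i + loc h i ^ δ) ht hd
    (fun s hs => h0 s hs.1 i)
    (G := fun s => (∑ j ∈ Finset.Iio i, kernel h (α 0) (β 0) j (i - j) * f s j * f s (i - j)) +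
        ∑' m, kernel h (α 1) (β 1) i m * f s (i + m) * f s m)
    (fun s hs => ?_) (fun s hs => ?_) (hi.imp_left fun h => by rwa [hf.init])
  · exact add_nonneg
      (Finset.sum_nonneg fun j _ =>
        mul_nonneg (mul_nonneg (kernel_pos hh _ _ _ _).le (h0 s hs.1 _)) (h0 s hs.1 _))
      (tsum_nonneg fun m =>
        mul_nonneg (mul_nonneg (kernel_pos hh _ _ _ _).le (h0 s hs.1 _)) (h0 s hs.1 _))
  · rw [hf.eqn s hs.1]
    exact le_rhs_of_nonneg hh hα hβ hαβ (h0 s hs.1) (hb s hs).2.1 (hb s hs).2.2 i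

lemma pos_add (hf : IsClassicalSolution h α β δ f₀ f) (hh : 0 < h) (hα : ∀ n, 0 ≤ α n)
    (hβ : ∀ n, 0 ≤ β n) (hδ : ∀ n, α n + β n < δ) (hf₀ : ∀ i, 0 ≤ f₀ i) {i j : ℕ+}
    (hi : ∀ t, 0 < t → 0 < f t i) (hj : ∀ t, 0 < t → 0 < f t j) {t : ℝ} (ht : 0 < t) :
    0 < f t (i + j) := by
  refine hf.pos_of_gain_pos hh hα hβ hδ hf₀ (i + j) (Or.inr fun s hs => ?_) ht
  have h0 : ∀ j, 0 ≤ f s j := hf.nonneg hh hα hβ hδ hf₀ hs.le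
  refine add_pos_of_pos_of_nonneg ?_ (tsum_nonneg fun m =>
    mul_nonneg (mul_nonneg (kernel_pos hh _ _ _ _).le (h0 _)) (h0 _))
  refine Finset.sum_pos' (fun k _ =>
    mul_nonneg (mul_nonneg (kernel_pos hh _ _ _ _).le (h0 _)) (h0 _))
    ⟨i, Finset.mem_Iio.2 (PNat.lt_add_right i j), ?_⟩
  rw [add_comm i j, PNat.add_sub]
  exact mul_pos (mul_pos (kernel_pos hh _ _ _ _) (hi s hs)) (hj s hs)

lemma pos_of_pos_add (hf : IsClassicalSolution h α β δ f₀ f) (hh : 0 < h) (hα : ∀ n, 0 ≤ α n)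
    (hβ : ∀ n, 0 ≤ β n) (hδ : ∀ n, α n + β n < δ) (hf₀ : ∀ i, 0 ≤ f₀ i) {i j : ℕ+}
    (hij : ∀ t, 0 < t → 0 < f t (i + j)) (hj : ∀ t, 0 < t → 0 < f t j) {t : ℝ} (ht : 0 < t) :
    0 < f t i := by
  refine hf.pos_of_gain_pos hh hα hβ hδ hf₀ i (Or.inr fun s hs => ?_) ht
  have h0 : ∀ j, 0 ≤ f s j := hf.nonneg hh hα hβ hδ hf₀ hs.le
  have hterm : ∀ m, 0 ≤ kernel h (α 1) (β 1) i m * f s (i + m) * f s m := fun m =>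
    mul_nonneg (mul_nonneg (kernel_pos hh _ _ _ _).le (h0 _)) (h0 _)
  obtain ⟨γ, hγ, hγδ, hαβ⟩ := exists_exponent hα hβ hδ
  obtain ⟨X, -, hb⟩ := hf.exists_weight_bound hh hγ hγδ.le s
  have hs' := summable_fragmentation_gain (isDominated_kernel hh (hα 1) (hβ 1) (hαβ 1))
    (fun i => (weight_pos hh i).le) (hb s ⟨hs.le, le_rfl⟩).2.1 i
  refine add_pos_of_nonneg_of_pos (Finset.sum_nonneg fun k _ =>
    mul_nonneg (mul_nonneg (kernel_pos hh _ _ _ _).le (h0 _)) (h0 _)) ?_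
  exact hs'.tsum_pos hterm j (mul_pos (mul_pos (kernel_pos hh _ _ _ _) (hij s hs)) (hj s hs))

end IsClassicalSolution

end ThreeWave

theorem theorem4
    (h : ℝ) (hh : 0 < h)
    (α β : Fin 3 → ℝ) (δ : ℝ)
    (hα : ∀ n, 0 ≤ α n) (hβ : ∀ n, 0 ≤ β n)
    (hδ : ∀ n, α n + β n < δ)
    (hδ₁ : 2 * α 0 + β 0 - 1 < δ)
    (f₀ : ℕ+ → ℝ) (hf₀ : ∀ i, 0 ≤ f₀ i)
    (κ : ℝ) (hκ : max δ (max 1 (2 - α 0 - β 0)) < κ)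
    (hmom : ThreeWave.moment h κ f₀ < ⊤)
    (f : ℝ → lp (fun _ : ℕ+ => ℝ) 1)
    (hf : ThreeWave.IsClassicalSolution h α β δ f₀ f)
    (d : ℕ) (hd : d = Nat.setGcd {n : ℕ | ∃ i : ℕ+, 0 < f₀ i ∧ n = (i : ℕ)})
    (t : ℝ) (ht : 0 < t) (i : ℕ+) :
    ((∃ m : ℕ+, (i : ℕ) = d * (m : ℕ)) → 0 < f t i) ∧
      ((¬ ∃ m : ℕ+, (i : ℕ) = d * (m : ℕ)) → f t i = 0) := by
  have hdvd : ∀ j : ℕ+, (∃ m : ℕ+, (j : ℕ) = d * (m : ℕ)) ↔ d ∣ j := fun j => by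
    refine ⟨fun ⟨m, hm⟩ => ⟨m, hm⟩, fun ⟨m, hm⟩ => ?_⟩
    have hm0 : 0 < m := Nat.pos_of_ne_zero fun h => j.ne_zero (by rw [hm, h, mul_zero])
    exact ⟨⟨m, hm0⟩, hm⟩
  -- If `d = 0`, no positive index is a multiple of `d`, and the first part is void.
  rw [hdvd]
  constructor
  · intro hi
    rw [hd] at hi
    refine ThreeWave.mem_of_setGcd_dvd (P := {i | ∀ t, 0 < t → 0 < f t i})
      (fun i j hi hj t ht => hf.pos_add hh hα hβ hδ hf₀ hi hj ht)
      (fun i j hi hj t ht => hf.pos_of_pos_add hh hα hβ hδ hf₀ hi hj ht) ?_ hi t ht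
    rintro _ ⟨p, hp, rfl⟩
    exact ⟨p, fun t ht => hf.pos_of_gain_pos hh hα hβ hδ hf₀ p (Or.inl hp) ht, rfl⟩
  · intro hi
    have h0 := hf.defect_eq_zero hh hα hβ hδ hf₀ (L := {i | d ∣ (i : ℕ)})
      (fun i j hi hj => by simpa using dvd_add hi hj)
      (fun i j hij hj => (Nat.dvd_add_left hj).1 (by simpa using hij))
      (fun j hj => hd ▸ Nat.setGcd_dvd_of_mem ⟨j, hj, rfl⟩) ht.le i
    rwa [ThreeWave.defect_of_notMem hi, abs_eq_zero] at h0
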